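/- Let $r,s>1$ be integers that are multiplicatively independent (i.e. they are not rational powers of each other). Put $m=\max(r,s)$, $$N_0=N_0(r,s)=\exp\bigl(288\,(12\,m(\log m)^4+8(\log m)^3+(\log m)^2)\bigr),$$ $$a_{20}=\frac16\cdot\frac{\pi^2}{2}\cdot 0.007\cdot\frac{1}{s^4\log s}\left(\frac1{\log s}-\frac1s\right),\qquad a_{20}'=\min\left(\frac1{N_0\log N_0},\ \frac{-\log\cos(\pi/s^2)}{2\log N_0}\right).$$ Then $a_{20}>0$ and $a_{20}'>0$, and the numerical factor $\frac16\cdot\frac{\pi^2}{2}\cdot 0.007$ in $a_{20}$ lies strictly between $0.0057$ and $0.0058$. Moreover, for all positive integers $K,l$ with $l\ge s^K$, the infinite products below converge, and: (i) for every integer $N\ge N_0$, $$\sum_{n=0}^{N-1}\ \prod_{k=K+1}^{\infty}\left|\cos\left(\frac{\pi r^n l}{s^k}\right)\right|\le 2N^{1-a_{20}};$$ (ii) for every integer $N\ge 0$, $$\sum_{n=0}^{N-1}\ \prod_{k=K+1}^{\infty}\left|\cos\left(\frac{\pi r^n l}{s^k}\right)\right|\le 2N^{1-a_{20}'}.$$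 -/

import Mathlib

/-- Two integers are multiplicatively dependent when they are rational powers of each other. -/
def MultDependent (r s : ℕ) : Prop :=
  (∃ q : ℚ, (r : ℝ) = (s : ℝ) ^ (q : ℝ)) ∧ (∃ q : ℚ, (s : ℝ) = (r : ℝ) ^ (q : ℝ))

/-- The factor `|cos (π x / s ^ k)|`. -/
noncomputable def cosFactor (s : ℕ) (x : ℝ) (k : ℕ) : ℝ :=
  |Real.cos (Real.pi * x / (s : ℝ) ^ k)|

/-- The infinite product of `|cos (π x / s ^ k)|` over all integers `k ≥ K + 1`. -/
noncomputable def cosProd (s K : ℕ) (x : ℝ) : ℝ :=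
  ∏' j : ℕ, cosFactor s x (K + 1 + j)

/-- The threshold `N₀(r, s)`, with `m = max r s`. -/
noncomputable def threshold (r s : ℕ) : ℝ :=
  let m : ℝ := ((max r s : ℕ) : ℝ)
  Real.exp (288 * (12 * m * Real.log m ^ 4 + 8 * Real.log m ^ 3 + Real.log m ^ 2))

/-- The shape `1 / (s ^ 4 log s) * (1 / log s - 1 / s)`. -/
noncomputable def expShape (s : ℕ) : ℝ :=
  1 / ((s : ℝ) ^ 4 * Real.log s) * (1 / Real.log s - 1 / (s : ℝ))

/-- The exponent saving valid for `N ≥ N₀(r, s)`. -/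
noncomputable def a20 (s : ℕ) : ℝ :=
  1 / 6 * (Real.pi ^ 2 / 2) * 0.007 * expShape s

/-- The exponent saving valid for all `N`. -/
noncomputable def a20All (r s : ℕ) : ℝ :=
  min (1 / (threshold r s * Real.log (threshold r s)))
    (-Real.log (Real.cos (Real.pi / (s : ℝ) ^ 2)) / (2 * Real.log (threshold r s)))

/-! ### The truncated products -/

/-! Dirichlet's theorem gives `j ≤ s^(12V)` and `m` with `Λ = j log r - m log s` tiny, and
independence makes `Λ ≠ 0`. Since `r^j = e^Λ s^m`, replacing `n` by `n + tj` multiplies the argument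
by `e^(tΛ)` and by a power of `s`, and the latter only shifts the indices of the factors. Keeping
`2V` consecutive factors and squaring leaves the Riesz product `cosSqProd` at the slowly moving
points `v e^(tΛ)`.

That Riesz product has mean `2^(-2V)` and Lipschitz constant at most `π s^(2V)`. Over `T = s^(6V)`
steps the points are almost equally spaced, finely enough for a Riemann sum to apply, and they sweep
a length at least comparable to one period. So their average is `O(2^(-2V))`, and Cauchy-Schwarz
gives `O(2^(-V))` for the original products (`sum_cosProd_progression_le`).

Averaging over shifts bounds the full sum by `6N/2^V + 3 s^(18V)` (`sum_cosProd_le`). Taking `V`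
with `s^(20V) ≤ N < s^(20(V+1))` saves a power of `N` of order `1/log s`, more than `a20` asks.
Below the threshold the trivial bound `N` suffices, as `N^a20All ≤ 2` there. -/

lemma cosFactor_nonneg (s : ℕ) (x : ℝ) (k : ℕ) : 0 ≤ cosFactor s x k := abs_nonneg _

lemma cosFactor_le_one (s : ℕ) (x : ℝ) (k : ℕ) : cosFactor s x k ≤ 1 := Real.abs_cos_le_one _

lemma multipliable_cosFactor {s : ℕ} (hs : 1 < s) (K : ℕ) (x : ℝ) :
    Multipliable fun j : ℕ => cosFactor s x (K + 1 + j) := by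
  have hs' : (1 : ℝ) < s := by exact_mod_cast hs
  have hsum : Summable fun j : ℕ => cosFactor s x (K + 1 + j) - 1 := by
    refine Summable.of_norm_bounded
      (g := fun j : ℕ => (Real.pi * x / (s : ℝ) ^ (K + 1)) ^ 2 / 2 * (((s : ℝ)⁻¹) ^ 2) ^ j) ?_ ?_
    · refine (summable_geometric_of_lt_one (by positivity) ?_).mul_left _
      exact pow_lt_one₀ (by positivity) (inv_lt_one_of_one_lt₀ hs') two_ne_zero
    · intro j
      have h1 := cosFactor_le_one s x (K + 1 + j)
      rw [Real.norm_eq_abs, abs_of_nonpos (by linarith)]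
      have h2 := Real.one_sub_sq_div_two_le_cos (x := Real.pi * x / (s : ℝ) ^ (K + 1 + j))
      have h3 := le_abs_self (Real.cos (Real.pi * x / (s : ℝ) ^ (K + 1 + j)))
      have h4 : (Real.pi * x / (s : ℝ) ^ (K + 1)) ^ 2 / 2 * (((s : ℝ)⁻¹) ^ 2) ^ j
          = (Real.pi * x / (s : ℝ) ^ (K + 1 + j)) ^ 2 / 2 := by
        rw [← pow_mul, mul_comm 2 j, pow_mul, inv_pow, pow_add (s : ℝ) (K + 1) j]
        field_simp
      rw [h4]
      unfold cosFactor
      linarith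
  simpa using Real.multipliable_one_add_of_summable hsum

/-- All factors lie in `[0, 1]`, so enlarging a finite partial product can only decrease it. -/
lemma cosProd_le_prod {s : ℕ} (hs : 1 < s) (K : ℕ) (x : ℝ) (S : Finset ℕ) :
    cosProd s K x ≤ ∏ j ∈ S, cosFactor s x (K + 1 + j) := by
  refine le_of_tendsto (multipliable_cosFactor hs K x).hasProd ?_
  filter_upwards [Filter.eventually_ge_atTop S] with A hA
  rw [← Finset.prod_sdiff hA]
  exact mul_le_of_le_one_left (Finset.prod_nonneg fun _ _ => cosFactor_nonneg _ _ _)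
    (Finset.prod_le_one (fun _ _ => cosFactor_nonneg _ _ _) fun _ _ => cosFactor_le_one _ _ _)

lemma cosProd_nonneg {s : ℕ} (hs : 1 < s) (K : ℕ) (x : ℝ) : 0 ≤ cosProd s K x := by
  refine ge_of_tendsto (multipliable_cosFactor hs K x).hasProd (Filter.Eventually.of_forall ?_)
  exact fun A => Finset.prod_nonneg fun _ _ => cosFactor_nonneg _ _ _

lemma cosProd_le_one {s : ℕ} (hs : 1 < s) (K : ℕ) (x : ℝ) : cosProd s K x ≤ 1 := by
  simpa using cosProd_le_prod hs K x ∅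

/-! ### Products of squared cosines along a geometric sequence -/

/-- The Riesz product `∏_{k < W} cos² (π s ^ k v)`. -/
noncomputable def cosSqProd (s W : ℕ) (v : ℝ) : ℝ :=
  ∏ k ∈ Finset.range W, Real.cos (Real.pi * ((s : ℝ) ^ k * v)) ^ 2

lemma cosSqProd_nonneg (s W : ℕ) (v : ℝ) : 0 ≤ cosSqProd s W v :=
  Finset.prod_nonneg fun _ _ => sq_nonneg _

lemma cosSqProd_le_one (s W : ℕ) (v : ℝ) : cosSqProd s W v ≤ 1 :=
  Finset.prod_le_one (fun _ _ => sq_nonneg _) fun _ _ => Real.cos_sq_le_one _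

lemma cosSqProd_neg (s W : ℕ) (v : ℝ) : cosSqProd s W (-v) = cosSqProd s W v := by
  simp [cosSqProd]

lemma continuous_cosSqProd (s W : ℕ) : Continuous (cosSqProd s W) := by
  unfold cosSqProd
  fun_prop

lemma cosSqProd_periodic (s W : ℕ) : Function.Periodic (cosSqProd s W) 1 := by
  intro v
  refine Finset.prod_congr rfl fun k _ => ?_
  have : Real.pi * ((s : ℝ) ^ k * (v + 1)) = Real.pi * ((s : ℝ) ^ k * v) + (s ^ k : ℕ) * Real.pi := by
    push_cast; ring
  rw [this, Real.cos_add_nat_mul_pi, mul_pow, ← pow_mul, mul_comm _ 2, pow_mul]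
  simp

lemma abs_cos_sq_sub_cos_sq_le (a b : ℝ) : |Real.cos a ^ 2 - Real.cos b ^ 2| ≤ |a - b| := by
  have h : Real.cos a ^ 2 - Real.cos b ^ 2 = (Real.cos (2 * a) - Real.cos (2 * b)) / 2 := by
    rw [Real.cos_sq, Real.cos_sq]; ring
  have h2 := Real.abs_cos_sub_cos_le (2 * a) (2 * b)
  rw [← mul_sub, abs_mul, abs_two] at h2
  rw [h, abs_div, abs_two]
  linarith

lemma abs_cosSqProd_sub_le {s : ℕ} (hs : 1 < s) (W : ℕ) (a b : ℝ) :
    |cosSqProd s W a - cosSqProd s W b| ≤ Real.pi * (s : ℝ) ^ W * |a - b| := by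
  have hs' : (2 : ℝ) ≤ s := by exact_mod_cast hs
  induction W with
  | zero => simp only [cosSqProd, Finset.range_zero, Finset.prod_empty, sub_self, abs_zero]; positivity
  | succ W ih =>
    have e : ∀ v, cosSqProd s (W + 1) v
        = cosSqProd s W v * Real.cos (Real.pi * ((s : ℝ) ^ W * v)) ^ 2 :=
      fun v => Finset.prod_range_succ _ _
    have h1 := abs_cos_sq_sub_cos_sq_le (Real.pi * ((s : ℝ) ^ W * a)) (Real.pi * ((s : ℝ) ^ W * b))
    rw [← mul_sub, ← mul_sub, abs_mul, abs_mul, abs_of_pos Real.pi_pos,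
      abs_of_nonneg (by positivity : (0 : ℝ) ≤ (s : ℝ) ^ W)] at h1
    rw [e, e]
    set A := cosSqProd s W a
    set B := cosSqProd s W b
    set c := Real.cos (Real.pi * ((s : ℝ) ^ W * a)) ^ 2
    set d := Real.cos (Real.pi * ((s : ℝ) ^ W * b)) ^ 2
    have hc : |c| ≤ 1 := by rw [abs_of_nonneg (sq_nonneg _)]; exact Real.cos_sq_le_one _
    have hB : |B| ≤ 1 := by
      rw [abs_of_nonneg (cosSqProd_nonneg _ _ _)]; exact cosSqProd_le_one _ _ _
    calc |A * c - B * d| = |(A - B) * c + B * (c - d)| := by ring_nf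
      _ ≤ |A - B| * |c| + |B| * |c - d| := by
        rw [← abs_mul, ← abs_mul]; exact abs_add_le _ _
      _ ≤ |A - B| * 1 + 1 * |c - d| := by gcongr
      _ ≤ 2 * (Real.pi * (s : ℝ) ^ W * |a - b|) := by linarith
      -- The Lipschitz constant doubles at each new factor, and `2 ≤ s` absorbs the doubling.
      _ ≤ s * (Real.pi * (s : ℝ) ^ W * |a - b|) := by gcongr
      _ = _ := by ring

/-- After doubling the angle, the oscillating parts form a rotated sum of all `s`-th roots of unity,
which vanishes. -/
lemma sum_cos_sq_shift {s : ℕ} (hs : 1 < s) (u : ℝ) :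
    ∑ d ∈ Finset.range s, Real.cos (Real.pi * ((u + d) / s)) ^ 2 = s / 2 := by
  have hs0 : (s : ℂ) ≠ 0 := by exact_mod_cast (by omega : s ≠ 0)
  have hz : ∑ d ∈ Finset.range s, Real.cos (2 * (Real.pi * ((u + d) / s))) = 0 := by
    have hroot := (Complex.isPrimitiveRoot_exp s (by omega)).geom_sum_eq_zero hs
    have h2 : ∑ d ∈ Finset.range s,
        Complex.exp (((2 * (Real.pi * ((u + d) / s)) : ℝ) : ℂ) * Complex.I) = 0 := by
      rw [← mul_zero (Complex.exp (2 * Real.pi * Complex.I * (u / s))), ← hroot, Finset.mul_sum]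
      refine Finset.sum_congr rfl fun d _ => ?_
      rw [← Complex.exp_nat_mul, ← Complex.exp_add]
      congr 1
      push_cast
      field_simp
    have h3 := congrArg Complex.re h2
    rw [Complex.re_sum] at h3
    simpa only [Complex.exp_ofReal_mul_I_re, Complex.zero_re] using h3
  simp_rw [Real.cos_sq]
  rw [Finset.sum_add_distrib, ← Finset.sum_div, ← Finset.sum_div, hz]
  simp [div_eq_mul_inv]

/-- Substitute `u = s v` and fold `[0, s]` onto `[0, 1]`: the later factors are 1-periodic in `u`,
while the first factor averages to `1/2` over the `s` shifts. -/
lemma integral_cosSqProd {s : ℕ} (hs : 1 < s) (W : ℕ) :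
    ∫ v in (0 : ℝ)..1, cosSqProd s W v = (1 / 2) ^ W := by
  have hs0 : (s : ℝ) ≠ 0 := by exact_mod_cast (by omega : s ≠ 0)
  induction W with
  | zero => simp [cosSqProd]
  | succ W ih =>
    have e : ∀ v, cosSqProd s (W + 1) v
        = Real.cos (Real.pi * (s * v / s)) ^ 2 * cosSqProd s W (s * v) := by
      intro v
      unfold cosSqProd
      rw [Finset.prod_range_succ', mul_comm, pow_zero, one_mul, mul_div_cancel_left₀ _ hs0]
      congr 1
      refine Finset.prod_congr rfl fun k _ => ?_
      rw [pow_succ (s : ℝ), mul_assoc]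
    have hcont : Continuous fun u : ℝ => Real.cos (Real.pi * (u / s)) ^ 2 * cosSqProd s W u := by
      have := continuous_cosSqProd s W
      fun_prop
    simp_rw [e]
    rw [intervalIntegral.integral_comp_mul_left
      (fun u : ℝ => Real.cos (Real.pi * (u / s)) ^ 2 * cosSqProd s W u) hs0]
    have hsplit := intervalIntegral.sum_integral_adjacent_intervals
      (f := fun u : ℝ => Real.cos (Real.pi * (u / s)) ^ 2 * cosSqProd s W u)
      (μ := MeasureTheory.volume) (a := fun k : ℕ => (k : ℝ)) (n := s)
      (fun k _ => hcont.intervalIntegrable _ _)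
    simp only [Nat.cast_zero] at hsplit
    rw [mul_zero, mul_one, ← hsplit]
    have hpiece : ∀ k : ℕ,
        ∫ u in (k : ℝ)..((k + 1 : ℕ) : ℝ), Real.cos (Real.pi * (u / s)) ^ 2 * cosSqProd s W u
        = ∫ u in (0 : ℝ)..1, Real.cos (Real.pi * ((u + k) / s)) ^ 2 * cosSqProd s W u := by
      intro k
      have h := intervalIntegral.integral_comp_add_right (a := 0) (b := 1)
        (fun u : ℝ => Real.cos (Real.pi * (u / s)) ^ 2 * cosSqProd s W u) (k : ℝ)
      rw [zero_add, add_comm (1 : ℝ)] at h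
      push_cast
      rw [← h]
      refine intervalIntegral.integral_congr fun u _ => ?_
      have := (cosSqProd_periodic s W).nat_mul k u
      rw [mul_one] at this
      simp only [this]
    simp_rw [hpiece]
    rw [← intervalIntegral.integral_finsetSum]
    · simp_rw [← Finset.sum_mul, sum_cos_sq_shift hs]
      rw [intervalIntegral.integral_const_mul, ih, smul_eq_mul, pow_succ]
      field_simp
    · intro k _
      have := continuous_cosSqProd s W
      exact Continuous.intervalIntegrable (by fun_prop) _ _

lemma integral_cosSqProd_le {s : ℕ} (hs : 1 < s) (W : ℕ) {a b : ℝ} (hab : a ≤ b) :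
    ∫ v in a..b, cosSqProd s W v ≤ (b - a + 1) * (1 / 2) ^ W := by
  have hint : ∀ c d, IntervalIntegrable (cosSqProd s W) MeasureTheory.volume c d :=
    fun c d => (continuous_cosSqProd s W).intervalIntegrable c d
  have hb : b ≤ a + (⌈b - a⌉₊ : ℝ) := by linarith [Nat.le_ceil (b - a)]
  have h0 : ∫ v in a..b, cosSqProd s W v ≤ ∫ v in a..(a + (⌈b - a⌉₊ : ℝ)), cosSqProd s W v :=
    intervalIntegral.integral_mono_interval le_rfl hab hb
      (Filter.Eventually.of_forall fun v => cosSqProd_nonneg s W v) (hint _ _)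
  have h1 := (cosSqProd_periodic s W).intervalIntegral_add_zsmul_eq (⌈b - a⌉₊ : ℤ) a hint
  rw [(cosSqProd_periodic s W).intervalIntegral_add_eq a 0] at h1
  simp only [zsmul_eq_mul, mul_one, Int.cast_natCast, zero_add, integral_cosSqProd hs] at h1
  rw [h1] at h0
  refine h0.trans ?_
  gcongr
  exact (Nat.ceil_lt_add_one (by linarith)).le

/-- Riemann sum comparison: on each gap the function stays within (Lipschitz constant) × `2h` of its
value at the left endpoint, and the gap integrals add up to one integral over a length at most
`2hT`. -/
lemma sum_cosSqProd_le {s : ℕ} (hs : 1 < s) (W T : ℕ) (v : ℕ → ℝ) (h : ℝ) (h0 : 0 < h)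
    (hl : ∀ t < T, h / 2 ≤ v (t + 1) - v t) (hu : ∀ t < T, v (t + 1) - v t ≤ 2 * h) :
    h / 2 * ∑ t ∈ Finset.range T, cosSqProd s W (v t)
      ≤ (2 * h * T + 1) * (1 / 2) ^ W + Real.pi * (s : ℝ) ^ W * (2 * h) ^ 2 * T := by
  have hint : ∀ c d, IntervalIntegrable (cosSqProd s W) MeasureTheory.volume c d :=
    fun c d => (continuous_cosSqProd s W).intervalIntegrable c d
  have key : ∀ t ∈ Finset.range T, h / 2 * cosSqProd s W (v t)
      ≤ (∫ u in (v t)..(v (t + 1)), cosSqProd s W u) + Real.pi * (s : ℝ) ^ W * (2 * h) ^ 2 := by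
    intro t ht
    have hl' := hl t (Finset.mem_range.1 ht)
    have hu' := hu t (Finset.mem_range.1 ht)
    set L := Real.pi * (s : ℝ) ^ W
    have hL : 0 ≤ L := by positivity
    have hlow : ∫ u in (v t)..(v (t + 1)), (cosSqProd s W (v t) - L * (2 * h))
        ≤ ∫ u in (v t)..(v (t + 1)), cosSqProd s W u := by
      refine intervalIntegral.integral_mono_on (by linarith) (by simp) (hint _ _) ?_
      intro u hu2
      have h1 := abs_cosSqProd_sub_le hs W (v t) u
      have h2 : |v t - u| ≤ 2 * h := by
        rw [abs_le]; constructor <;> linarith [hu2.1, hu2.2]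
      have h3 : L * |v t - u| ≤ L * (2 * h) := by gcongr
      linarith [le_abs_self (cosSqProd s W (v t) - cosSqProd s W u)]
    rw [intervalIntegral.integral_const, smul_eq_mul, mul_sub] at hlow
    have h4 : h / 2 * cosSqProd s W (v t) ≤ (v (t + 1) - v t) * cosSqProd s W (v t) :=
      mul_le_mul_of_nonneg_right hl' (cosSqProd_nonneg _ _ _)
    have h5 : (v (t + 1) - v t) * (L * (2 * h)) ≤ (2 * h) * (L * (2 * h)) := by gcongr
    linarith
  have hsum := Finset.sum_le_sum key
  rw [← Finset.mul_sum, Finset.sum_add_distrib,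
    intervalIntegral.sum_integral_adjacent_intervals (fun k _ => hint _ _)] at hsum
  have htele : v T - v 0 = ∑ t ∈ Finset.range T, (v (t + 1) - v t) :=
    (Finset.sum_range_sub v T).symm
  have hle : v T - v 0 ≤ 2 * h * T := by
    rw [htele]
    refine (Finset.sum_le_sum fun t ht => hu t (Finset.mem_range.1 ht)).trans ?_
    simp [mul_comm]
  have hge : v 0 ≤ v T := by
    have : 0 ≤ v T - v 0 := by
      rw [htele]
      exact Finset.sum_nonneg fun t ht => by linarith [hl t (Finset.mem_range.1 ht)]
    linarith
  have hI := integral_cosSqProd_le hs W hge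
  have : (v T - v 0 + 1) * (1 / 2 : ℝ) ^ W ≤ (2 * h * T + 1) * (1 / 2) ^ W := by gcongr
  simp only [Finset.sum_const, Finset.card_range, nsmul_eq_mul] at hsum
  linarith

lemma mul_exp_le_exp_sub_exp (a b : ℝ) : (b - a) * Real.exp a ≤ Real.exp b - Real.exp a := by
  have h := Real.add_one_le_exp (b - a)
  have h2 : Real.exp b = Real.exp (b - a) * Real.exp a := by rw [← Real.exp_add]; ring_nf
  nlinarith [Real.exp_pos a]

/-- Along `v e^{tΛ}` with `T |Λ| ≤ 1 / 2`, the gaps are comparable to `v |Λ|`. -/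
lemma sum_cosSqProd_exp_le {s : ℕ} (hs : 1 < s) (W T : ℕ) {v Λ : ℝ} (hv : 0 < v) (hΛ : Λ ≠ 0)
    (hT : T * |Λ| ≤ 1 / 2) :
    v * |Λ| / 2 * ∑ t ∈ Finset.range T, cosSqProd s W (v * Real.exp (t * Λ))
      ≤ (2 * (v * |Λ|) * T + 1) * (1 / 2) ^ W
        + Real.pi * (s : ℝ) ^ W * (2 * (v * |Λ|)) ^ 2 * T := by
  have hh : 0 < v * |Λ| := mul_pos hv (abs_pos.2 hΛ)
  have hhalf : Real.exp (1 / 2) ≤ 2 := by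
    have h1 : Real.exp (1 / 2) ^ 2 = Real.exp 1 := by rw [← Real.exp_nat_mul]; norm_num
    nlinarith [Real.exp_one_lt_d9, Real.exp_pos (1 / 2)]
  have hhalf' : 1 / 2 ≤ Real.exp (-(1 / 2)) := by
    have h1 : Real.exp (-(1 / 2)) * Real.exp (1 / 2) = 1 := by rw [← Real.exp_add]; norm_num
    nlinarith [Real.exp_pos (-(1 / 2))]
  have hbd : ∀ t : ℕ, t ≤ T → |(t : ℝ) * Λ| ≤ 1 / 2 := by
    intro t ht
    rw [abs_mul, Nat.abs_cast]
    exact le_trans (by gcongr) hT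
  have hexp : ∀ t : ℕ, t ≤ T → 1 / 2 ≤ Real.exp (t * Λ) ∧ Real.exp (t * Λ) ≤ 2 := by
    intro t ht
    have h := abs_le.1 (hbd t ht)
    exact ⟨hhalf'.trans (Real.exp_le_exp.2 h.1), (Real.exp_le_exp.2 h.2).trans hhalf⟩
  have hgap : ∀ t : ℕ, Λ * Real.exp (t * Λ) ≤ Real.exp ((t + 1 : ℕ) * Λ) - Real.exp (t * Λ) ∧
      Real.exp ((t + 1 : ℕ) * Λ) - Real.exp (t * Λ) ≤ Λ * Real.exp ((t + 1 : ℕ) * Λ) := by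
    intro t
    have h1 := mul_exp_le_exp_sub_exp (t * Λ) ((t + 1 : ℕ) * Λ)
    have h2 := mul_exp_le_exp_sub_exp ((t + 1 : ℕ) * Λ) (t * Λ)
    have h3 : ((t + 1 : ℕ) : ℝ) * Λ - t * Λ = Λ := by push_cast; ring
    have h4 : (t : ℝ) * Λ - ((t + 1 : ℕ) : ℝ) * Λ = -Λ := by push_cast; ring
    rw [h3] at h1
    rw [h4] at h2
    constructor <;> linarith
  rcases lt_or_gt_of_ne hΛ with hneg | hpos
  -- Here the points decrease; evenness of the Riesz product allows reflecting them.
  · rw [abs_of_neg hneg] at hh ⊢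
    have := sum_cosSqProd_le hs W T (fun t => -(v * Real.exp (t * Λ))) (v * -Λ) hh ?_ ?_
    · simpa only [cosSqProd_neg] using this
    · intro t ht
      have h1 := (hgap t).2
      have h2 : Λ * Real.exp ((t + 1 : ℕ) * Λ) ≤ Λ * (1 / 2) :=
        mul_le_mul_of_nonpos_left (hexp _ ht).1 hneg.le
      have := mul_le_mul_of_nonneg_left (h1.trans h2) hv.le
      linarith
    · intro t ht
      have h1 := (hgap t).1
      have h2 : Λ * 2 ≤ Λ * Real.exp (t * Λ) :=
        mul_le_mul_of_nonpos_left (hexp _ ht.le).2 hneg.le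
      have := mul_le_mul_of_nonneg_left (h2.trans h1) hv.le
      linarith
  · rw [abs_of_pos hpos] at hh ⊢
    refine sum_cosSqProd_le hs W T (fun t => v * Real.exp (t * Λ)) (v * Λ) hh ?_ ?_
    · intro t ht
      have h1 := (hgap t).1
      have h2 : Λ * (1 / 2) ≤ Λ * Real.exp (t * Λ) :=
        mul_le_mul_of_nonneg_left (hexp _ ht.le).1 hpos.le
      have := mul_le_mul_of_nonneg_left (h2.trans h1) hv.le
      linarith
    · intro t ht
      have h1 := (hgap t).2
      have h2 : Λ * Real.exp ((t + 1 : ℕ) * Λ) ≤ Λ * 2 :=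
        mul_le_mul_of_nonneg_left (hexp _ ht).2 hpos.le
      have := mul_le_mul_of_nonneg_left (h1.trans h2) hv.le
      linarith

/-! ### Sums along a geometric progression that nearly resonates with the powers of `s` -/

/-- Keep only the factors of index `K + M + q - k` with `k < W`: there the powers `s^K` and `s^M`
cancel. `W ≤ q` keeps these indices above `K`. -/
lemma cosProd_sq_le_cosSqProd {s : ℕ} (hs : 1 < s) (K M : ℕ) {W q : ℕ} (hWq : W ≤ q) (w : ℝ) :
    cosProd s K ((s : ℝ) ^ K * (w * (s : ℝ) ^ M)) ^ 2 ≤ cosSqProd s W (w / (s : ℝ) ^ q) := by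
  have hs0 : (s : ℝ) ≠ 0 := by exact_mod_cast (by omega : s ≠ 0)
  have h := cosProd_le_prod hs K ((s : ℝ) ^ K * (w * (s : ℝ) ^ M))
    ((Finset.range W).image fun k => M + (q - 1 - k))
  rw [Finset.prod_image] at h
  · have h2 := pow_le_pow_left₀ (cosProd_nonneg hs _ _) h 2
    refine h2.trans (le_of_eq ?_)
    rw [← Finset.prod_pow]
    refine Finset.prod_congr rfl fun k hk => ?_
    have hk' := Finset.mem_range.1 hk
    unfold cosFactor
    rw [sq_abs]
    have e : K + 1 + (M + (q - 1 - k)) = K + M + (q - k) := by omega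
    have e2 : (s : ℝ) ^ q = (s : ℝ) ^ (q - k) * (s : ℝ) ^ k := by
      rw [← pow_add]; congr 1; omega
    rw [e, e2, pow_add, pow_add]
    congr 2
    field_simp
  · intro a ha b hb hab
    have ha' := Finset.mem_range.1 (Finset.mem_coe.1 ha)
    have hb' := Finset.mem_range.1 (Finset.mem_coe.1 hb)
    simp only at hab
    omega

lemma sum_cosProd_progression_le {s : ℕ} (hs : 1 < s) (K m : ℕ) {V T : ℕ} (hV : 1 ≤ V)
    (hTV : T = s ^ (6 * V)) {x Λ : ℝ} (hx : 0 < x) (hΛ : Λ ≠ 0) (hT : T * |Λ| ≤ 1 / 2)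
    (hxΛ : 1 ≤ x * |Λ|) :
    ∑ t ∈ Finset.range T,
        cosProd s K ((s : ℝ) ^ K * (x * Real.exp (t * Λ) * (s : ℝ) ^ (t * m)))
      ≤ 6 * T * (1 / 2) ^ V := by
  have hs' : (1 : ℝ) < s := by exact_mod_cast hs
  have hs2 : (2 : ℝ) ≤ s := by exact_mod_cast hs
  have hs0 : (0 : ℝ) < s := by linarith
  have hTr : (T : ℝ) = (s : ℝ) ^ (6 * V) := by rw [hTV]; push_cast; rfl
  have hT1 : (1 : ℝ) ≤ T := by rw [hTr]; exact one_le_pow₀ hs'.le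
  -- Scaling by `s^q` brings the swept length `T v |Λ|` into `[1, s)`: at least one period, yet with
  -- small gaps.
  obtain ⟨q, hq1, hq2⟩ := exists_nat_pow_near (x := x * |Λ| * T) (by nlinarith) hs'
  have hqW : 2 * V ≤ q := by
    have h1 : (s : ℝ) ^ (6 * V) < (s : ℝ) ^ (q + 1) := by
      refine lt_of_le_of_lt ?_ hq2
      rw [← hTr]
      nlinarith
    have := (pow_lt_pow_iff_right₀ hs').1 h1
    omega
  have hsq : (0 : ℝ) < (s : ℝ) ^ q := by positivity
  set v := x / (s : ℝ) ^ q with hvdef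
  have hv : 0 < v := by positivity
  have hh : v * |Λ| = x * |Λ| / (s : ℝ) ^ q := by rw [hvdef]; ring
  have hTh1 : 1 ≤ v * |Λ| * T := by
    rw [hh, div_mul_eq_mul_div, le_div_iff₀ hsq]; linarith
  have hTh2 : v * |Λ| * T ≤ s := by
    rw [hh, div_mul_eq_mul_div, div_le_iff₀ hsq]
    rw [pow_succ] at hq2
    linarith
  have hhpos : 0 < v * |Λ| := mul_pos hv (abs_pos.2 hΛ)
  have hmain := sum_cosSqProd_exp_le hs (2 * V) T hv hΛ hT
  set h := v * |Λ| with hhdef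
  set Z := ∑ t ∈ Finset.range T, cosSqProd s (2 * V) (v * Real.exp (t * Λ))
  have hpow : (s : ℝ) ^ (2 * V) * s ≤ T * (1 / 2) ^ (2 * V) := by
    rw [hTr, one_div, inv_pow, ← div_eq_mul_inv, le_div_iff₀ (by positivity)]
    calc (s : ℝ) ^ (2 * V) * s * 2 ^ (2 * V)
        ≤ (s : ℝ) ^ (2 * V) * (s : ℝ) ^ (2 * V) * (s : ℝ) ^ (2 * V) := by
          gcongr
          · exact le_self_pow₀ hs'.le (by omega)
      _ = (s : ℝ) ^ (6 * V) := by rw [← pow_add, ← pow_add]; congr 1; omega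
  -- The main and error terms give `2 (3 + 4 · 3.15) < 36`; the square `36` makes the final root
  -- exact.
  have hZle : Z ≤ 36 * T * (1 / 2) ^ (2 * V) := by
    have hδ : (0 : ℝ) < (1 / 2) ^ (2 * V) := by positivity
    have hpi := Real.pi_lt_d2
    have hA : Real.pi * (s : ℝ) ^ (2 * V) * (2 * h) ^ 2 * T
        ≤ h * (4 * 3.15 * (T * (1 / 2) ^ (2 * V))) := by
      calc Real.pi * (s : ℝ) ^ (2 * V) * (2 * h) ^ 2 * T
          = h * (4 * Real.pi * ((s : ℝ) ^ (2 * V) * (h * T))) := by ring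
        _ ≤ h * (4 * 3.15 * ((s : ℝ) ^ (2 * V) * s)) := by gcongr
        _ ≤ _ := by gcongr
    have hB : (2 * h * T + 1) * (1 / 2 : ℝ) ^ (2 * V) ≤ h * (3 * (T * (1 / 2) ^ (2 * V))) := by
      have : (2 * h * T + 1) * (1 / 2 : ℝ) ^ (2 * V) ≤ (3 * (h * T)) * (1 / 2) ^ (2 * V) := by
        gcongr; linarith
      linarith
    have hC : h * Z ≤ h * (36 * T * (1 / 2) ^ (2 * V)) := by
      have : 0 ≤ h * (T * (1 / 2 : ℝ) ^ (2 * V)) := by positivity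
      nlinarith
    exact le_of_mul_le_mul_left hC hhpos
  have hsq2 : (∑ t ∈ Finset.range T,
      cosProd s K ((s : ℝ) ^ K * (x * Real.exp (t * Λ) * (s : ℝ) ^ (t * m)))) ^ 2
      ≤ T * Z := by
    refine (sq_sum_le_card_mul_sum_sq).trans ?_
    rw [Finset.card_range]
    gcongr
    refine Finset.sum_le_sum fun t _ => ?_
    refine (cosProd_sq_le_cosSqProd hs K (t * m) hqW _).trans (le_of_eq ?_)
    congr 1
    rw [hvdef]; ring
  refine le_of_sq_le_sq ?_ (by positivity)
  calc _ ≤ T * Z := hsq2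
    _ ≤ T * (36 * T * (1 / 2) ^ (2 * V)) := by gcongr
    _ = _ := by rw [mul_comm 2 V, pow_mul]; ring

/-! ### Near-resonances between the powers of `r` and of `s` -/

/-- Dirichlet approximation of `log r / log s`. An equality `r^j = s^m` would, on taking roots, make
each base a rational power of the other. -/
lemma exists_near_resonance {r s : ℕ} (hr : 1 < r) (hs : 1 < s) (hrs : ¬ MultDependent r s)
    {J : ℕ} (hJ : 0 < J) :
    ∃ j m : ℕ, 0 < j ∧ j ≤ J ∧ r ^ j ≠ s ^ m ∧
      |j * Real.log r - m * Real.log s| ≤ Real.log s / (J + 1) := by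
  have hr' : (1 : ℝ) < r := by exact_mod_cast hr
  have hs' : (1 : ℝ) < s := by exact_mod_cast hs
  have hlr := Real.log_pos hr'
  have hls := Real.log_pos hs'
  obtain ⟨j, hj0, hjJ, hj⟩ := Real.exists_nat_abs_mul_sub_round_le (Real.log r / Real.log s) hJ
  have hnn : 0 ≤ round (j * (Real.log r / Real.log s)) := by
    rw [round_eq]
    exact Int.floor_nonneg.2 (by positivity)
  obtain ⟨m, hm⟩ := Int.eq_ofNat_of_zero_le hnn
  rw [hm, Int.cast_natCast] at hj
  refine ⟨j, m, hj0, hjJ, ?_, ?_⟩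
  · intro heq
    apply hrs
    have heq' : (r : ℝ) ^ j = (s : ℝ) ^ m := by exact_mod_cast heq
    have hm0 : m ≠ 0 := by
      rintro rfl
      rw [pow_zero] at heq
      exact absurd heq (Nat.one_lt_pow hj0.ne' hr).ne'
    constructor
    · refine ⟨(m : ℚ) / j, ?_⟩
      push_cast
      rw [div_eq_mul_inv, Real.rpow_mul (by positivity), Real.rpow_natCast, ← heq',
        Real.pow_rpow_inv_natCast (by positivity) hj0.ne']
    · refine ⟨(j : ℚ) / m, ?_⟩
      push_cast
      rw [div_eq_mul_inv, Real.rpow_mul (by positivity), Real.rpow_natCast, heq',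
        Real.pow_rpow_inv_natCast (by positivity) hm0]
  · have e : j * Real.log r - m * Real.log s
        = (j * (Real.log r / Real.log s) - m) * Real.log s := by field_simp
    rw [e, abs_mul, abs_of_pos hls]
    calc _ ≤ 1 / ((J : ℝ) + 1) * Real.log s := by gcongr
      _ = _ := by ring

lemma exp_resonance {r s : ℕ} (hr : 1 < r) (hs : 1 < s) (j m : ℕ) :
    Real.exp (j * Real.log r - m * Real.log s) * (s : ℝ) ^ m = (r : ℝ) ^ j := by
  have hr' : (0 : ℝ) < r := by exact_mod_cast (by omega : 0 < r)
  have hs' : (0 : ℝ) < s := by exact_mod_cast (by omega : 0 < s)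
  rw [Real.exp_sub, Real.exp_nat_mul, Real.exp_nat_mul, Real.exp_log hr', Real.exp_log hs']
  field_simp

/-- Distinct integers `r^j`, `s^m` differ by at least 1, so `|Λ|` is at least about `r^(-j)`. The
loss `4 ≤ r^2` explains `j + 2`. -/
lemma one_le_pow_mul_abs_resonance {r s : ℕ} (hr : 1 < r) (hs : 1 < s) {j m : ℕ}
    (hne : r ^ j ≠ s ^ m) (hsmall : |j * Real.log r - m * Real.log s| ≤ 1 / 2) {n : ℕ}
    (hn : j + 2 ≤ n) : 1 ≤ (r : ℝ) ^ n * |j * Real.log r - m * Real.log s| := by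
  have hr2 : (2 : ℝ) ≤ r := by exact_mod_cast hr
  have hE := exp_resonance hr hs j m
  set Λ := j * Real.log r - m * Real.log s
  have h1 : (1 : ℝ) ≤ |(r : ℝ) ^ j - (s : ℝ) ^ m| := by
    have : (1 : ℤ) ≤ |(r : ℤ) ^ j - (s : ℤ) ^ m| :=
      Int.one_le_abs (sub_ne_zero.2 (by exact_mod_cast hne))
    exact_mod_cast this
  have h2 := Real.abs_exp_sub_one_le (x := Λ) (by linarith)
  have h3 : (r : ℝ) ^ j - (s : ℝ) ^ m = (Real.exp Λ - 1) * (s : ℝ) ^ m := by rw [← hE]; ring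
  have hsm : (0 : ℝ) < (s : ℝ) ^ m := by
    have : (0 : ℝ) < s := by exact_mod_cast (by omega : 0 < s)
    positivity
  rw [h3, abs_mul, abs_of_pos hsm] at h1
  have h4 : (s : ℝ) ^ m ≤ 2 * (r : ℝ) ^ j := by
    have : 1 / 2 ≤ Real.exp Λ := by
      have := Real.add_one_le_exp Λ
      linarith [(abs_le.1 hsmall).1]
    rw [← hE]
    nlinarith
  calc (1 : ℝ) ≤ |Real.exp Λ - 1| * (s : ℝ) ^ m := h1
    _ ≤ (2 * |Λ|) * (2 * (r : ℝ) ^ j) := by gcongr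
    _ = (2 ^ 2 * (r : ℝ) ^ j) * |Λ| := by ring
    _ ≤ ((r : ℝ) ^ 2 * (r : ℝ) ^ j) * |Λ| := by gcongr
    _ = (r : ℝ) ^ (j + 2) * |Λ| := by ring
    _ ≤ (r : ℝ) ^ n * |Λ| := by
      gcongr
      linarith

/-- Shifting the range by `tj` costs at most `Tj`. Averaging over `t < T` turns the shifted sums
into progression sums, with the trivial bound for starts below `n₀`. -/
lemma sum_le_of_sum_progression_le (g : ℕ → ℝ) (h0 : ∀ n, 0 ≤ g n) (h1 : ∀ n, g n ≤ 1)
    {j T n₀ : ℕ} (hT : 0 < T) {B : ℝ} (hB : 0 ≤ B)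
    (hprog : ∀ n, n₀ ≤ n → ∑ t ∈ Finset.range T, g (n + t * j) ≤ T * B) (N : ℕ) :
    ∑ n ∈ Finset.range N, g n ≤ N * B + n₀ + T * j := by
  have hshift : ∀ t ∈ Finset.range T,
      ∑ n ∈ Finset.range N, g n ≤ ∑ n ∈ Finset.range N, g (n + t * j) + T * j := by
    intro t ht
    have ha : ∑ n ∈ Finset.range N, g n ≤ ∑ n ∈ Finset.range (t * j + N), g n :=
      Finset.sum_le_sum_of_subset_of_nonneg (Finset.range_mono (by omega)) fun _ _ _ => h0 _
    rw [Finset.sum_range_add] at ha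
    have hb : ∑ n ∈ Finset.range (t * j), g n ≤ (T : ℝ) * j := by
      calc ∑ n ∈ Finset.range (t * j), g n ≤ ∑ n ∈ Finset.range (t * j), (1 : ℝ) :=
            Finset.sum_le_sum fun _ _ => h1 _
        _ = (t : ℝ) * j := by simp
        _ ≤ (T : ℝ) * j := by gcongr; exact (Finset.mem_range.1 ht).le
    simp only [add_comm _ (t * j)]
    linarith
  have hsum := Finset.sum_le_sum hshift
  rw [Finset.sum_add_distrib, Finset.sum_const, Finset.sum_const, Finset.card_range,
    nsmul_eq_mul, nsmul_eq_mul,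
    Finset.sum_comm (f := fun t n => g (n + t * j))] at hsum
  have hrow : ∀ n ∈ Finset.range N, ∑ t ∈ Finset.range T, g (n + t * j)
      ≤ T * B + if n < n₀ then (T : ℝ) else 0 := by
    intro n _
    split_ifs with hn
    · have : ∑ t ∈ Finset.range T, g (n + t * j) ≤ ∑ t ∈ Finset.range T, (1 : ℝ) :=
        Finset.sum_le_sum fun _ _ => h1 _
      have h2 : (0 : ℝ) ≤ T * B := by positivity
      simp at this
      linarith
    · rw [add_zero]; exact hprog n (by omega)
  have hrows := Finset.sum_le_sum hrow
  rw [Finset.sum_add_distrib, ← Finset.sum_filter, Finset.sum_const, Finset.card_range,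
    nsmul_eq_mul] at hrows
  have hcard : ∑ n ∈ (Finset.range N).filter (fun n => n < n₀), (T : ℝ) ≤ n₀ * T := by
    rw [Finset.sum_const, nsmul_eq_mul]
    gcongr
    refine (Finset.card_le_card (t := Finset.range n₀) fun n hn => ?_).trans_eq
      (Finset.card_range n₀)
    exact Finset.mem_range.2 (Finset.mem_filter.1 hn).2
  have hTpos : (0 : ℝ) < T := by exact_mod_cast hT
  refine le_of_mul_le_mul_left ?_ hTpos
  linarith

/-- The bound with a free parameter `V`. -/
lemma sum_cosProd_le {r s : ℕ} (hr : 1 < r) (hs : 1 < s) (hrs : ¬ MultDependent r s) {K l : ℕ}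
    (hl : s ^ K ≤ l) {V : ℕ} (hV : 1 ≤ V) (N : ℕ) :
    ∑ n ∈ Finset.range N, cosProd s K ((r : ℝ) ^ n * l)
      ≤ N * (6 * (1 / 2) ^ V) + 3 * (s : ℝ) ^ (18 * V) := by
  have hr' : (0 : ℝ) < r := by exact_mod_cast (by omega : 0 < r)
  have hs' : (1 : ℝ) < s := by exact_mod_cast hs
  have hs2 : (2 : ℝ) ≤ s := by exact_mod_cast hs
  have hs0 : (0 : ℝ) < s := by linarith
  -- `J = T^2` for `T = s^(6V)` forces `T |Λ| ≤ s / T ≤ 1/2`, while the shift cost `T j` stays at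
  -- most `s^(18V)`.
  obtain ⟨j, m, hj0, hjJ, hne, hΛ⟩ :=
    exists_near_resonance hr hs hrs (J := s ^ (12 * V)) (by positivity)
  have hE := exp_resonance hr hs j m
  have hlow := fun n => one_le_pow_mul_abs_resonance hr hs hne (n := n)
  set Λ := j * Real.log r - m * Real.log s with hΛdef
  have hTΛ : ((s ^ (6 * V) : ℕ) : ℝ) * |Λ| ≤ 1 / 2 := by
    have hP : (s : ℝ) ^ 2 ≤ (s : ℝ) ^ (6 * V) := pow_le_pow_right₀ hs'.le (by omega)
    have hP2 : (s : ℝ) ^ (12 * V) = (s : ℝ) ^ (6 * V) * (s : ℝ) ^ (6 * V) := by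
      rw [← pow_add]; congr 1; omega
    have hlog : Real.log s ≤ s := by linarith [Real.log_le_sub_one_of_pos hs0]
    push_cast at hΛ ⊢
    set P := (s : ℝ) ^ (6 * V)
    have hP0 : 0 < P := by positivity
    calc P * |Λ| ≤ P * (Real.log s / ((s : ℝ) ^ (12 * V) + 1)) := by gcongr
      _ ≤ P * (s / (P * P)) := by
        rw [hP2]
        gcongr
        linarith
      _ = s / P := by field_simp
      _ ≤ 1 / 2 := by
        rw [div_le_div_iff₀ hP0 two_pos]
        nlinarith
  have hT1 : (1 : ℝ) ≤ ((s ^ (6 * V) : ℕ) : ℝ) := by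
    exact_mod_cast Nat.one_le_pow _ _ (by omega)
  have hΛ2 : |Λ| ≤ 1 / 2 := by nlinarith [abs_nonneg Λ]
  have hΛ0 : Λ ≠ 0 := by
    intro h
    have := hlow (j + 2) hΛ2 le_rfl
    rw [h, abs_zero, mul_zero] at this
    linarith
  have hθ : (1 : ℝ) ≤ l / (s : ℝ) ^ K := by
    rw [le_div_iff₀ (by positivity), one_mul]
    exact_mod_cast hl
  have hmain := sum_le_of_sum_progression_le (fun n => cosProd s K ((r : ℝ) ^ n * l))
    (fun n => cosProd_nonneg hs _ _) (fun n => cosProd_le_one hs _ _)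
    (j := j) (T := s ^ (6 * V)) (n₀ := j + 2) (by positivity) (B := 6 * (1 / 2) ^ V)
    (by positivity) ?_ N
  · refine hmain.trans ?_
    have hj : (j : ℝ) ≤ (s : ℝ) ^ (12 * V) := by exact_mod_cast hjJ
    have h18 : (s : ℝ) ^ (18 * V) = (s : ℝ) ^ (6 * V) * (s : ℝ) ^ (12 * V) := by
      rw [← pow_add]; congr 1; omega
    have h12 : (s : ℝ) ^ (12 * V) ≤ (s : ℝ) ^ (18 * V) := pow_le_pow_right₀ hs'.le (by omega)
    have h1 : (s : ℝ) ^ 1 ≤ (s : ℝ) ^ (18 * V) := pow_le_pow_right₀ hs'.le (by omega)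
    have hTj : (s : ℝ) ^ (6 * V) * j ≤ (s : ℝ) ^ (18 * V) := by rw [h18]; gcongr
    push_cast
    linarith
  · intro n hn
    have hx : (1 : ℝ) ≤ (r : ℝ) ^ n * (l / (s : ℝ) ^ K) * |Λ| := by
      have := hlow n hΛ2 hn
      calc (1 : ℝ) ≤ ((r : ℝ) ^ n * |Λ|) * 1 := by linarith
        _ ≤ ((r : ℝ) ^ n * |Λ|) * (l / (s : ℝ) ^ K) := by gcongr
        _ = _ := by ring
    have := sum_cosProd_progression_le hs K m hV rfl
      (x := (r : ℝ) ^ n * (l / (s : ℝ) ^ K)) (by positivity) hΛ0 hTΛ hx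
    refine le_trans (le_of_eq ?_) (this.trans (le_of_eq (by ring)))
    refine Finset.sum_congr rfl fun t _ => ?_
    congr 1
    have e : (r : ℝ) ^ (n + t * j) = (r : ℝ) ^ n * (Real.exp (t * Λ) * (s : ℝ) ^ (t * m)) := by
      rw [pow_add, mul_comm t j, pow_mul, ← hE, mul_pow, ← Real.exp_nat_mul, ← pow_mul,
        mul_comm m t]
    rw [e]
    field_simp

/-! ### The constants -/

lemma expShape_pos {s : ℕ} (hs : 1 < s) : 0 < expShape s := by
  have hs' : (1 : ℝ) < s := by exact_mod_cast hs
  have hl := Real.log_pos hs'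
  have h : Real.log s < s := by linarith [Real.log_le_sub_one_of_pos (by linarith : (0 : ℝ) < s)]
  have h2 : 1 / (s : ℝ) < 1 / Real.log s := one_div_lt_one_div_of_lt hl h
  unfold expShape
  have : 0 < 1 / Real.log s - 1 / (s : ℝ) := by linarith
  positivity

lemma lt_a20 {s : ℕ} (hs : 1 < s) : 0.0057 * expShape s < a20 s := by
  have h := Real.pi_gt_d2
  unfold a20
  gcongr
  · exact expShape_pos hs
  · nlinarith

lemma a20_lt {s : ℕ} (hs : 1 < s) : a20 s < 0.0058 * expShape s := by
  have h := Real.pi_lt_d2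
  have h0 := Real.pi_pos
  unfold a20
  gcongr
  · exact expShape_pos hs
  · nlinarith

lemma a20_pos {s : ℕ} (hs : 1 < s) : 0 < a20 s :=
  lt_trans (mul_pos (by norm_num) (expShape_pos hs)) (lt_a20 hs)

lemma half_lt_log {m : ℕ} (hm : 1 < m) : (1 / 2 : ℝ) < Real.log m := by
  have h2 : (2 : ℝ) ≤ m := by exact_mod_cast hm
  have := Real.log_le_log two_pos h2
  linarith [Real.log_two_gt_d9]

lemma a20_mul_log_le {s : ℕ} (hs : 1 < s) : a20 s * Real.log s ≤ 0.001 := by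
  have hs2 : (2 : ℝ) ≤ s := by exact_mod_cast hs
  have hl := half_lt_log hs
  have hl0 : 0 < Real.log s := by linarith
  have h1 : expShape s * Real.log s ≤ 1 / 8 := by
    have e : expShape s * Real.log s = (1 / (s : ℝ) ^ 4) * (1 / Real.log s - 1 / (s : ℝ)) := by
      unfold expShape; field_simp
    have h16 : 1 / (s : ℝ) ^ 4 ≤ 1 / 16 := by
      rw [show (16 : ℝ) = 2 ^ 4 by norm_num]
      gcongr
    have hB : 1 / Real.log s ≤ 2 := by
      rw [div_le_iff₀ hl0]; linarith
    have hs0 : 0 ≤ 1 / (s : ℝ) := by positivity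
    rw [e]
    calc _ ≤ 1 / (s : ℝ) ^ 4 * 2 := by gcongr; linarith
      _ ≤ 1 / 16 * 2 := by gcongr
      _ = 1 / 8 := by norm_num
  have := mul_le_mul_of_nonneg_right (a20_lt hs).le hl0.le
  linarith

/-- All that is needed of the threshold: `80 = 20 · 4` guarantees `V ≥ 4` later, and `200 s`
dominates the remaining comparisons. -/
lemma le_log_threshold {r s : ℕ} (hs : 1 < s) :
    80 * Real.log s ≤ Real.log (threshold r s) ∧ 200 * (s : ℝ) ≤ Real.log (threshold r s) := by
  have hm : 1 < max r s := lt_of_lt_of_le hs (le_max_right _ _)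
  have hl := half_lt_log hm
  have hs0 : (0 : ℝ) < s := by exact_mod_cast (by omega : 0 < s)
  have hsm : (s : ℝ) ≤ ((max r s : ℕ) : ℝ) := by exact_mod_cast le_max_right r s
  have hls : Real.log s ≤ Real.log ((max r s : ℕ) : ℝ) := Real.log_le_log hs0 hsm
  unfold threshold
  simp only [Real.log_exp]
  set m : ℝ := ((max r s : ℕ) : ℝ)
  have hm0 : 0 < m := hs0.trans_le hsm
  set L := Real.log m
  have h4 : 1 / 16 ≤ L ^ 4 := by
    calc (1 / 16 : ℝ) = (1 / 2) ^ 4 := by norm_num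
      _ ≤ L ^ 4 := by gcongr
  have h2 : 1 / 4 ≤ L ^ 2 := by
    calc (1 / 4 : ℝ) = (1 / 2) ^ 2 := by norm_num
      _ ≤ L ^ 2 := by gcongr
  have h3 : 1 / 4 * L ≤ L ^ 3 := by
    calc 1 / 4 * L ≤ L ^ 2 * L := by gcongr
      _ = L ^ 3 := by ring
  have hm4 : m * (1 / 16) ≤ m * L ^ 4 := by gcongr
  constructor <;> linarith

lemma a20All_pos {r s : ℕ} (hs : 1 < s) : 0 < a20All r s := by
  have hs2 : (2 : ℝ) ≤ s := by exact_mod_cast hs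
  have hlog : 0 < Real.log (threshold r s) := by linarith [(le_log_threshold (r := r) hs).2]
  have hthr : 0 < threshold r s := Real.exp_pos _
  have hpi := Real.pi_pos
  have h4 : (4 : ℝ) ≤ (s : ℝ) ^ 2 := by nlinarith
  have hle : Real.pi / (s : ℝ) ^ 2 ≤ Real.pi / 4 := by gcongr
  have hpos : 0 < Real.pi / (s : ℝ) ^ 2 := by positivity
  have hc0 : 0 < Real.cos (Real.pi / (s : ℝ) ^ 2) :=
    Real.cos_pos_of_mem_Ioo ⟨by linarith, by linarith⟩
  have hc1 : Real.cos (Real.pi / (s : ℝ) ^ 2) < 1 := by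
    rw [← Real.cos_zero]
    exact Real.cos_lt_cos_of_nonneg_of_le_pi le_rfl (by linarith) hpos
  have hneg := Real.log_neg hc0 hc1
  refine lt_min (by positivity) (div_pos (by linarith) (by positivity))

/-- The first entry of the minimum is already small enough: it is at most `s^(-7) / 200`, while
`expShape s ≥ s^(-7)` and `1/200 < 0.0057`. -/
lemma a20All_le_a20 {r s : ℕ} (hs : 1 < s) : a20All r s ≤ a20 s := by
  have hs' : (1 : ℝ) < s := by exact_mod_cast hs
  have hs2 : (2 : ℝ) ≤ s := by exact_mod_cast hs
  have hs0 : (0 : ℝ) < s := by linarith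
  have hl0 := Real.log_pos hs'
  have hthr := (le_log_threshold (r := r) hs).2
  have htpos : 0 < threshold r s := Real.exp_pos _
  have hls : Real.log s ≤ s - 1 := Real.log_le_sub_one_of_pos hs0
  have h1 : 1 / (s : ℝ) ^ 7 ≤ expShape s := by
    have e : expShape s = (s - Real.log s) / ((s : ℝ) ^ 5 * (Real.log s * Real.log s)) := by
      unfold expShape; field_simp
    rw [e, div_le_div_iff₀ (by positivity) (by positivity)]
    have : Real.log s * Real.log s ≤ s * s := by gcongr <;> linarith
    calc 1 * ((s : ℝ) ^ 5 * (Real.log s * Real.log s)) ≤ 1 * ((s : ℝ) ^ 5 * (s * s)) := by gcongr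
      _ = 1 * (s : ℝ) ^ 7 := by ring
      _ ≤ (s - Real.log s) * (s : ℝ) ^ 7 := by gcongr; linarith
  have hbig : (s : ℝ) ^ 7 * 200 ≤ threshold r s * Real.log (threshold r s) := by
    have ht : (s : ℝ) ^ 7 ≤ threshold r s := by
      rw [← Real.exp_log htpos]
      calc (s : ℝ) ^ 7 ≤ Real.exp s ^ 7 := by
            gcongr
            linarith [Real.add_one_le_exp (s : ℝ)]
        _ = Real.exp (7 * s) := by rw [← Real.exp_nat_mul]; norm_num
        _ ≤ _ := by apply Real.exp_le_exp.2; linarith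
    gcongr
    nlinarith
  calc a20All r s ≤ 1 / (threshold r s * Real.log (threshold r s)) := min_le_left _ _
    _ ≤ 1 / ((s : ℝ) ^ 7 * 200) := by gcongr
    _ = (1 / 200) * (1 / (s : ℝ) ^ 7) := by field_simp
    _ ≤ 0.0057 * expShape s := by gcongr; norm_num
    _ ≤ a20 s := (lt_a20 hs).le

/-- `a20 s * log s ≤ 0.001` makes `N^a20` at most `e^(0.02(V+1))`, far below the gain `2^V`. The
factor `9 = 6 + 3` collects both terms of `sum_cosProd_le`. -/
lemma rpow_a20_mul_le {s V : ℕ} (hs : 1 < s) (hV : 4 ≤ V) {N : ℝ} (hN : 1 ≤ N)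
    (hNV : N ≤ (s : ℝ) ^ (20 * (V + 1))) : 9 * (1 / 2) ^ V * N ^ a20 s ≤ 2 := by
  have hs' : (1 : ℝ) < s := by exact_mod_cast hs
  have hV' : (4 : ℝ) ≤ V := by exact_mod_cast hV
  have h1 : N ^ a20 s ≤ Real.exp (0.02 * (V + 1)) := by
    rw [Real.rpow_def_of_pos (by linarith)]
    apply Real.exp_le_exp.2
    have hlog : Real.log N ≤ 20 * (V + 1) * Real.log s := by
      have := Real.log_le_log (by linarith) hNV
      rw [Real.log_pow] at this
      push_cast at this
      exact this
    have h2 := mul_le_mul_of_nonneg_right hlog (a20_pos hs).le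
    have h3 := mul_le_mul_of_nonneg_left (a20_mul_log_le hs)
      (by positivity : (0 : ℝ) ≤ 20 * (V + 1))
    linarith
  have h2 : Real.exp (0.02 * (V + 1)) ≤ 2 ^ V / 8 := by
    have e : (2 : ℝ) ^ V / 8 = Real.exp ((V - 3) * Real.log 2) := by
      rw [sub_mul, Real.exp_sub, Real.exp_nat_mul, Real.exp_log two_pos,
        show (3 : ℝ) = (3 : ℕ) by norm_num, Real.exp_nat_mul, Real.exp_log two_pos]
      norm_num
    rw [e]
    apply Real.exp_le_exp.2
    nlinarith [Real.log_two_gt_d9]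
  calc 9 * (1 / 2) ^ V * N ^ a20 s ≤ 9 * (1 / 2) ^ V * (2 ^ V / 8) := by
        gcongr
        exact h1.trans h2
    _ = 9 / 8 * ((1 / 2) * 2) ^ V := by rw [mul_pow]; ring
    _ ≤ 2 := by norm_num

lemma sum_cosProd_le_of_threshold_le {r s : ℕ} (hr : 1 < r) (hs : 1 < s)
    (hrs : ¬ MultDependent r s) {K l : ℕ} (hl : s ^ K ≤ l) {N : ℕ}
    (hN : threshold r s ≤ (N : ℝ)) :
    ∑ n ∈ Finset.range N, cosProd s K ((r : ℝ) ^ n * l) ≤ 2 * (N : ℝ) ^ (1 - a20 s) := by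
  have hs' : (1 : ℝ) < s := by exact_mod_cast hs
  have hs2 : (2 : ℝ) ≤ s := by exact_mod_cast hs
  have hs0 : (0 : ℝ) < s := by linarith
  have htpos : 0 < threshold r s := Real.exp_pos _
  have ht80 : (s : ℝ) ^ 80 ≤ N := by
    refine le_trans ?_ hN
    rw [← Real.log_le_log_iff (by positivity) htpos, Real.log_pow]
    exact_mod_cast (le_log_threshold (r := r) hs).1
  have hN1 : (1 : ℝ) ≤ N := (one_le_pow₀ hs'.le).trans ht80
  have hN0 : (0 : ℝ) < N := by linarith
  -- The exponent 20 leaves room for `s^(18V) 2^V ≤ s^(19V) ≤ N`.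
  obtain ⟨V, hV1, hV2⟩ := exists_nat_pow_near hN1 (one_lt_pow₀ hs' (by norm_num : 20 ≠ 0))
  rw [← pow_mul] at hV1 hV2
  have hV : 4 ≤ V := by
    have := (pow_lt_pow_iff_right₀ hs').1 (ht80.trans_lt hV2)
    omega
  have hsum := sum_cosProd_le hr hs hrs hl (show 1 ≤ V by omega) N
  have h18 : (s : ℝ) ^ (18 * V) ≤ N * (1 / 2) ^ V := by
    rw [one_div, inv_pow, ← div_eq_mul_inv, le_div_iff₀ (by positivity)]
    calc (s : ℝ) ^ (18 * V) * 2 ^ V ≤ (s : ℝ) ^ (18 * V) * (s : ℝ) ^ V := by gcongr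
      _ = (s : ℝ) ^ (19 * V) := by rw [← pow_add]; congr 1; omega
      _ ≤ (s : ℝ) ^ (20 * V) := pow_le_pow_right₀ hs'.le (by omega)
      _ ≤ N := hV1
  have hfin := rpow_a20_mul_le hs hV hN1 hV2.le
  have hpos : 0 < (N : ℝ) ^ a20 s := Real.rpow_pos_of_pos hN0 _
  rw [Real.rpow_sub hN0, Real.rpow_one, ← mul_div_assoc, le_div_iff₀ hpos]
  calc _ ≤ (N * (9 * (1 / 2) ^ V)) * (N : ℝ) ^ a20 s := by
        gcongr
        linarith
    _ = N * (9 * (1 / 2) ^ V * (N : ℝ) ^ a20 s) := by ring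
    _ ≤ N * 2 := by gcongr
    _ = 2 * N := by ring

lemma sum_cosProd_le_of_le_threshold {r s : ℕ} (hs : 1 < s) (K l : ℕ) {N : ℕ}
    (hN : (N : ℝ) ≤ threshold r s) :
    ∑ n ∈ Finset.range N, cosProd s K ((r : ℝ) ^ n * l) ≤ 2 * (N : ℝ) ^ (1 - a20All r s) := by
  have hs2 : (2 : ℝ) ≤ s := by exact_mod_cast hs
  have htriv : ∑ n ∈ Finset.range N, cosProd s K ((r : ℝ) ^ n * l) ≤ N := by
    refine (Finset.sum_le_sum fun n _ => cosProd_le_one hs K _).trans ?_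
    simp
  rcases Nat.eq_zero_or_pos N with rfl | hpos
  · simp only [Finset.range_zero, Finset.sum_empty]
    positivity
  have hN1 : (1 : ℝ) ≤ N := by exact_mod_cast hpos
  have hN0 : (0 : ℝ) < N := by linarith
  have hlog : 0 < Real.log (threshold r s) := by linarith [(le_log_threshold (r := r) hs).2]
  have ht2 : 2 ≤ threshold r s := by
    have htpos : 0 < threshold r s := Real.exp_pos _
    have := Real.log_le_sub_one_of_pos htpos
    linarith [(le_log_threshold (r := r) hs).2]
  -- The first entry of the minimum gives `N^a20All ≤ exp(1 / N₀)`.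
  have hle : (N : ℝ) ^ a20All r s ≤ 2 := by
    rw [Real.rpow_def_of_pos hN0, ← Real.exp_log two_pos]
    apply Real.exp_le_exp.2
    calc Real.log N * a20All r s
        ≤ Real.log (threshold r s) * (1 / (threshold r s * Real.log (threshold r s))) := by
          gcongr
          · exact (a20All_pos hs).le
          · exact min_le_left _ _
      _ = 1 / threshold r s := by field_simp
      _ ≤ 1 / 2 := by gcongr
      _ ≤ Real.log 2 := by linarith [Real.log_two_gt_d9]
  have hp : 0 < (N : ℝ) ^ a20All r s := Real.rpow_pos_of_pos hN0 _
  rw [Real.rpow_sub hN0, Real.rpow_one, ← mul_div_assoc, le_div_iff₀ hp]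
  calc _ ≤ (N : ℝ) * 2 := by gcongr
    _ = 2 * N := by ring

theorem mainTheorem3 (r s : ℕ) (hr : 1 < r) (hs : 1 < s) (hrs : ¬ MultDependent r s) :
    -- the constants are positive, and the first one is `≈ 0.0057 * expShape s`
    0 < a20 s ∧ 0.0057 * expShape s < a20 s ∧ a20 s < 0.0058 * expShape s ∧
    0 < a20All r s ∧
    ∀ K l : ℕ, 0 < K → 0 < l → s ^ K ≤ l →
      -- the infinite products converge
      (∀ n : ℕ, Multipliable fun j : ℕ => cosFactor s ((r : ℝ) ^ n * l) (K + 1 + j)) ∧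
      -- the bound for `N ≥ N₀(r, s)`
      (∀ N : ℕ, threshold r s ≤ (N : ℝ) →
        ∑ n ∈ Finset.range N, cosProd s K ((r : ℝ) ^ n * l) ≤ 2 * (N : ℝ) ^ (1 - a20 s)) ∧
      -- the bound for all `N`, with the smaller constant
      (∀ N : ℕ,
        ∑ n ∈ Finset.range N, cosProd s K ((r : ℝ) ^ n * l) ≤ 2 * (N : ℝ) ^ (1 - a20All r s)) := by
  refine ⟨a20_pos hs, lt_a20 hs, a20_lt hs, a20All_pos hs, fun K l _ _ hl => ⟨fun n =>
    multipliable_cosFactor hs K _, fun N hN => sum_cosProd_le_of_threshold_le hr hs hrs hl hN,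
    fun N => ?_⟩⟩
  rcases le_total (N : ℝ) (threshold r s) with hN | hN
  · exact sum_cosProd_le_of_le_threshold hs K l hN
  · refine (sum_cosProd_le_of_threshold_le hr hs hrs hl hN).trans ?_
    have hN1 : (1 : ℝ) ≤ N := by
      refine le_trans ?_ hN
      have hs2 : (2 : ℝ) ≤ s := by exact_mod_cast hs
      have := Real.log_le_sub_one_of_pos (show 0 < threshold r s from Real.exp_pos _)
      linarith [(le_log_threshold (r := r) hs).2]
    gcongr
    exact a20All_le_a20 hs
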